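/- Let $K$ be a number field with ring of integers $\mathcal{O}_K$, and let $d=2$ or $d=3$. Let $b,x_0\in K$, where we can write $x_0=s/t$ and $b=u/w$ with $s,t,u,w\in\mathcal{O}_K$, $t,w\neq 0$, such that the ideals $(s,t)$ and $(u,w)$ both equal $\mathcal{O}_K$. Let $f(x)=x^d-bx$, write $f^n$ for the $n$-th iterate of $f$ (with $f^0(x)=x$), $\Delta(g)$ for the discriminant of a polynomial $g$, $v_{\mathfrak p}$ for the normalized additive valuation at a prime $\mathfrak p$ of $\mathcal{O}_K$ (a nonzero prime ideal), with $v_{\mathfrak p}(0)=\infty$, and $f^{-n}(x_0)=\{\alpha\in\overline{K} : f^n(\alpha)=x_0\}$. Suppose that 1. there is a prime $\mathfrak p_1$ of $\mathcal{O}_K$ with $v_{\mathfrak p_1}(b)\geq 1$ and $v_{\mathfrak p_1}(x_0)=1$; and 2. for each $n\geq 1$, there is a prime $\mathfrak p$ of $\mathcal{O}_K$ with $\mathfrak p\nmid stuwd(d-1)$ such that $v_{\mathfrak p}(\Delta(f^n(x)-x_0))$ is a positive odd integer, and such that $v_{\mathfrak p}(\Delta(f^{\ell}(x)-x_0))=0$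 for all $0\leq \ell<n$. Then for all $n\geq 0$, $$\mathrm{Gal}\big(K(f^{-n}(x_0))/K\big)\cong [S_d]^n,$$ where $[S_d]^n$ is the $n$-fold iterated wreath product of the symmetric group $S_d$, acting on $d$ letters, with itself: $[S_d]^0$ is trivial and $[S_d]^{n+1}=[S_d]^n\wr S_d=([S_d]^n)^d\rtimes S_d$, with $S_d$ permuting the coordinates; equivalently, $[S_d]^n$ is the automorphism group of the $d$-ary rooted tree with $n$ levels. -/

import Mathlib

open Polynomial IsDedekindDomain NumberField

/-- The (permutational) wreath product `G ≀ Sym(Ω)`, i.e. the semidirect product `G^Ω ⋊ Sym(Ω)` in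
which `Sym(Ω)` permutes the coordinates of `G^Ω`. -/
abbrev PermWreath (G Ω : Type) [Group G] : Type :=
  (Ω → G) ⋊[(mulAutArrow : Equiv.Perm Ω →* MulAut (Ω → G))] Equiv.Perm Ω

/-- The underlying group of `[S_d]^n`, bundled with its group structure. -/
def iterSymBundled (d : ℕ) : ℕ → (G : Type) × Group G
  | 0 => ⟨Unit, inferInstance⟩
  | n + 1 =>
    letI : Group (iterSymBundled d n).1 := (iterSymBundled d n).2
    ⟨PermWreath (iterSymBundled d n).1 (Fin d), inferInstance⟩

/-- `[S_d]^n`, the `n`-fold iterated wreath product of the symmetric group `S_d` (acting on `d`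
letters) with itself: `[S_d]^0` is trivial and `[S_d]^(n+1) = [S_d]^n ≀ S_d`. Equivalently, this is
the automorphism group of the `d`-ary rooted tree with `n` levels: `S_d` permutes the `d` subtrees
below the root, and each coordinate of `([S_d]^n)^d` acts on one of them. -/
def IterSym (d n : ℕ) : Type := (iterSymBundled d n).1

instance instGroupIterSym (d n : ℕ) : Group (IterSym d n) := (iterSymBundled d n).2

/-- The set `f^{-n}(x₀)` of `n`-th preimages of `x₀` in the algebraic closure of `K`. -/
def iterPreimage {K : Type*} [Field K] (f : K[X]) (x₀ : K) (n : ℕ) : Set (AlgebraicClosure K) :=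
  {α | (fun y => aeval y f)^[n] α = algebraMap K (AlgebraicClosure K) x₀}

/-- The field `K(f^{-n}(x₀))`. -/
noncomputable abbrev preimageField {K : Type*} [Field K] (f : K[X]) (x₀ : K) (n : ℕ) :
    IntermediateField K (AlgebraicClosure K) :=
  IntermediateField.adjoin K (iterPreimage f x₀ n)

/-- The polynomial `f^n(x) - x₀`, where `f^n` is the `n`-th iterate of `f` (and `f^0 = x`). -/
noncomputable def iterSubC {K : Type*} [Field K] (f : K[X]) (x₀ : K) (n : ℕ) : K[X] :=
  f.comp^[n] X - C x₀

/-- `HasOrd 𝔭 x k` says that `x ≠ 0` and that the normalized additive valuation `v_𝔭(x)` is `k`.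
(Mathlib's valuation is multiplicative: it sends `x` to `exp (-v_𝔭(x))`, and `0` to `0`.) -/
def HasOrd {K : Type*} [Field K] [NumberField K] (𝔭 : HeightOneSpectrum (𝓞 K)) (x : K) (k : ℤ) :
    Prop :=
  𝔭.valuation K x = WithZero.exp (-k)

/-! The iterated preimages of `x₀` form a `d`-ary tree carrying an action of the absolute Galois
group, and every tree automorphism of its first `n` levels has to be realized. For `d ≤ 3` two facts
suffice (`mem_range_preimagePermHom_iff`): the action is transitive on each level, and on each level
below the root some element acts as a single transposition of two siblings. Conjugation then yields
all sibling transpositions; these generate the permutations of level `n + 1` preserving every fibre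
of `f`, and induction on `n` does the rest.

Transitivity is irreducibility of `f^n(x) - x₀`, which is Eisenstein at `𝔭₁`
(`irreducible_iterSubC`).

The transposition comes from inertia (`exists_actsAsSwap_of_odd_discr`). By the chain rule the
discriminant is, up to sign, the product of `f'` along the orbits of the roots. Unit discriminants
on the lower levels keep the points there distinct modulo a prime `Q` above `𝔭`, so inertia fixes
them. On the next level, the roots where `f'` is not a unit all lie in one fibre
(`image_eq_of_valuation_derivative_lt`). The product of `f'` over that fibre is minus the square of
the Vandermonde product `w` (`exists_sq_eq_prod_derivative_fiber`). The inertia field has the same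
value group as `K` (`exists_valuation_eq_of_inertia_fixed`), so an odd valuation prevents `w` from
being fixed by inertia. An element moving `w` permutes two or three letters oddly, hence is a
transposition there, and it fixes all other roots. -/

/-! ### Iterated wreath products as groups of leaf permutations -/

/-- The leaves of the `d`-ary rooted tree with `n` levels, as words read from the root. -/
def TreeWord (d : ℕ) : ℕ → Type
  | 0 => Unit
  | n + 1 => Fin d × TreeWord d n

/-- Two words agree in their first `j` letters. -/
def TreeWord.Agree {d : ℕ} : (n j : ℕ) → TreeWord d n → TreeWord d n → Prop
  | 0, _, _, _ => True
  | _ + 1, 0, _, _ => True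
  | n + 1, j + 1, x, y => x.1 = y.1 ∧ TreeWord.Agree n j x.2 y.2

theorem TreeWord.agree_zero {d : ℕ} : ∀ (n : ℕ) (x y : TreeWord d n), TreeWord.Agree n 0 x y
  | 0, _, _ => trivial
  | _ + 1, _, _ => trivial

theorem TreeWord.nonempty {d : ℕ} [NeZero d] : ∀ n : ℕ, Nonempty (TreeWord d n)
  | 0 => ⟨()⟩
  | n + 1 => let ⟨w⟩ := TreeWord.nonempty (d := d) n; ⟨(0, w)⟩

section Wreath

variable {G Ω X : Type} [Group G]

/-- The imprimitive action of a wreath product on `Ω × X`. -/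
def PermWreath.toPermProd (ρ : G →* Equiv.Perm X) : PermWreath G Ω →* Equiv.Perm (Ω × X) where
  toFun a :=
    { toFun := fun p => (a.right p.1, ρ (a.left (a.right p.1)) p.2)
      invFun := fun p => (a.right⁻¹ p.1, (ρ (a.left p.1))⁻¹ p.2)
      left_inv := fun p => by simp
      right_inv := fun p => by simp }
  map_one' := by ext p <;> simp
  map_mul' a b := by
    refine Equiv.ext fun p => Prod.ext ?_ ?_
    · simp
    · simp only [Equiv.coe_fn_mk, SemidirectProduct.mul_left, SemidirectProduct.mul_right,
        Pi.mul_apply, map_mul, Equiv.Perm.mul_apply]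
      have h : (mulAutArrow a.right b.left : Ω → G) (a.right (b.right p.1)) =
          b.left (b.right p.1) := by
        exact congrArg b.left (a.right.symm_apply_apply _)
      rw [h]

@[simp]
theorem PermWreath.toPermProd_apply (ρ : G →* Equiv.Perm X) (a : PermWreath G Ω) (p : Ω × X) :
    PermWreath.toPermProd ρ a p = (a.right p.1, ρ (a.left (a.right p.1)) p.2) := rfl

theorem PermWreath.toPermProd_injective [Nonempty X] {ρ : G →* Equiv.Perm X}
    (hρ : Function.Injective ρ) :
    Function.Injective (PermWreath.toPermProd ρ : PermWreath G Ω →* Equiv.Perm (Ω × X)) := by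
  intro a b hab
  obtain ⟨x₀⟩ := ‹Nonempty X›
  have key := fun i x => congrArg (fun π : Equiv.Perm (Ω × X) => π (i, x)) hab
  simp only [PermWreath.toPermProd_apply, Prod.mk.injEq] at key
  have hr : a.right = b.right := Equiv.ext fun i => (key i x₀).1
  refine SemidirectProduct.ext (funext fun j => hρ (Equiv.ext fun x => ?_)) hr
  have := (key (a.right⁻¹ j) x).2
  rw [← hr] at this
  simpa using this

end Wreath

/-- The action of `[S_d]^n` on the leaves of the `d`-ary rooted tree with `n` levels. -/
def IterSym.toPerm (d : ℕ) : (n : ℕ) → IterSym d n →* Equiv.Perm (TreeWord d n)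
  | 0 => 1
  | n + 1 => PermWreath.toPermProd (G := IterSym d n) (Ω := Fin d) (IterSym.toPerm d n)

theorem IterSym.toPerm_injective (d : ℕ) [NeZero d] :
    ∀ n : ℕ, Function.Injective (IterSym.toPerm d n)
  | 0 => fun (_ : Unit) (_ : Unit) _ => rfl
  | n + 1 =>
    have := TreeWord.nonempty (d := d) n
    PermWreath.toPermProd_injective (G := IterSym d n) (Ω := Fin d) (IterSym.toPerm_injective d n)

/-- The image of `[S_d]^n` consists of the permutations of the leaves which respect the tree. -/
theorem IterSym.mem_range_toPerm_iff (d : ℕ) [NeZero d] : ∀ (n : ℕ) (π : Equiv.Perm (TreeWord d n)),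
    π ∈ (IterSym.toPerm d n).range ↔
      ∀ j ≤ n, ∀ x y, TreeWord.Agree n j x y → TreeWord.Agree n j (π x) (π y)
  | 0, π => by
    refine ⟨fun _ _ _ _ _ _ => trivial, fun _ => ⟨1, ?_⟩⟩
    exact Equiv.ext fun (x : Unit) => (rfl : ((1 : Equiv.Perm (TreeWord d 0)) x : Unit) = π x)
  | n + 1, π => by
    constructor
    · rintro ⟨a, rfl⟩ j hj x y hxy
      cases j with
      | zero => trivial
      | succ j =>
        obtain ⟨h1, h2⟩ := hxy
        have ih := (IterSym.mem_range_toPerm_iff d n _).1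
          ⟨(show PermWreath (IterSym d n) (Fin d) from a).left
            ((show PermWreath (IterSym d n) (Fin d) from a).right x.1), rfl⟩ j (by omega) _ _ h2
        let a' : PermWreath (IterSym d n) (Fin d) := a
        have h3 : IterSym.toPerm d n (a'.left (a'.right x.1)) y.2 =
            IterSym.toPerm d n (a'.left (a'.right y.1)) y.2 := by rw [h1]
        refine ⟨congrArg a'.right h1, ?_⟩
        change TreeWord.Agree n j _ (IterSym.toPerm d n (a'.left (a'.right y.1)) y.2)
        rw [← h3]
        exact ih
    · intro h
      obtain ⟨w₀⟩ := TreeWord.nonempty (d := d) n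
      let P : Fin d × TreeWord d n ≃ Fin d × TreeWord d n := π
      -- The case `j = 1` of the hypothesis: the first letter of the image depends only on the first
      -- letter, which defines `σ`.
      have hP1 : ∀ i w w', (P (i, w)).1 = (P (i, w')).1 := fun i w w' =>
        (h 1 (by omega) (i, w) (i, w') ⟨rfl, TreeWord.agree_zero _ _ _⟩).1
      have hsurj : Function.Surjective fun i => (P (i, w₀)).1 := fun i => by
        obtain ⟨⟨k, w⟩, hk⟩ := P.surjective (i, w₀)
        exact ⟨k, by simp only [hP1 k w₀ w, hk]⟩
      let σ : Equiv.Perm (Fin d) :=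
        Equiv.ofBijective _ (Finite.injective_iff_bijective.1 (Finite.injective_iff_surjective.2 hsurj))
      have hσ : ∀ i w, (P (i, w)).1 = σ i := fun i w => hP1 i w w₀
      have hb : ∀ i, Function.Bijective fun w => (P (i, w)).2 := fun i => by
        constructor
        · intro w w' hw
          have : P (i, w) = P (i, w') := Prod.ext (hP1 _ _ _) hw
          exact (Prod.mk.inj (P.injective this)).2
        · intro w
          obtain ⟨⟨k, w'⟩, hk⟩ := P.surjective (σ i, w)
          have : k = i := σ.injective (by rw [← hσ k w', hk])
          subst this
          exact ⟨w', by simp only [hk]⟩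
      have hτ : ∀ i, ∃ g : IterSym d n, IterSym.toPerm d n g = Equiv.ofBijective _ (hb i) :=
        fun i => (IterSym.mem_range_toPerm_iff d n _).2 fun j hj x y hxy =>
          (h (j + 1) (by omega) (i, x) (i, y) ⟨rfl, hxy⟩).2
      choose g hg using hτ
      -- Coordinates of the wreath product are indexed by the target subtree, whereas `g` is indexed
      -- by the source; hence `σ⁻¹`.
      refine ⟨(⟨fun j => g (σ⁻¹ j), σ⟩ : PermWreath (IterSym d n) (Fin d)), ?_⟩
      refine Equiv.ext fun (p : Fin d × TreeWord d n) => Prod.ext (hσ p.1 p.2).symm ?_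
      change IterSym.toPerm d n (g (σ⁻¹ (σ p.1))) p.2 = (P p).2
      rw [show σ⁻¹ (σ p.1) = p.1 from σ.symm_apply_apply _, hg]
      rfl

/-! ### Trees of preimages -/

/-- The iterated preimages of a point under a map with fibres of size `d` form a `d`-ary tree. -/
theorem exists_treeWord_equiv {Ω : Type*} (f : Ω → Ω) (d : ℕ) [NeZero d] : ∀ (n : ℕ) (x : Ω),
    (∀ k < n, ∀ y, f^[k] y = x → Nat.card {z // f z = y} = d) →
    ∃ e : TreeWord d n ≃ {y // f^[n] y = x}, ∀ j ≤ n, ∀ v w,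
      TreeWord.Agree n j v w ↔ f^[n - j] (e v) = f^[n - j] (e w)
  | 0, x, _ => by
    refine ⟨⟨fun _ => ⟨x, rfl⟩, fun _ => (), fun _ => rfl, fun y => Subtype.ext y.2.symm⟩, ?_⟩
    intro j _ v w
    exact ⟨fun _ => rfl, fun _ => trivial⟩
  | n + 1, x, h => by
    have h0 : Nat.card {z // f z = x} = d := h 0 (by omega) x rfl
    have : Finite {z // f z = x} := Nat.finite_of_card_ne_zero (by rw [h0]; exact NeZero.ne d)
    let c : Fin d ≃ {z // f z = x} := (finCongr h0.symm).trans (Finite.equivFin _).symm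
    -- Recursion at the root: each child `c i` of `x` becomes the root of a tree with one level
    -- fewer.
    have ih := fun i => exists_treeWord_equiv f d n (c i : Ω) fun k hk y hy =>
      h (k + 1) (by omega) y (by rw [Function.iterate_succ_apply', hy, (c i).2])
    choose e he using ih
    let E : Fin d × TreeWord d n → {y // f^[n + 1] y = x} := fun p =>
      ⟨e p.1 p.2, by rw [Function.iterate_succ_apply', (e p.1 p.2).2, (c p.1).2]⟩
    have htop : ∀ p, f^[n] (E p) = c p.1 := fun p => (e p.1 p.2).2
    have hE : Function.Bijective E := by
      constructor
      · intro p q hpq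
        have h1 : p.1 = q.1 := c.injective (Subtype.ext (by rw [← htop, ← htop, hpq]))
        obtain ⟨i, v⟩ := p
        obtain ⟨i', w⟩ := q
        obtain rfl : i = i' := h1
        exact Prod.ext rfl ((e i).injective (Subtype.ext (congrArg (fun z => z.1) hpq :)))
      · rintro ⟨y, hy⟩
        let z : {z // f z = x} := ⟨f^[n] y, by rw [← Function.iterate_succ_apply' f n y, hy]⟩
        refine ⟨(c.symm z, (e (c.symm z)).symm ⟨y, by simp [z]⟩), Subtype.ext ?_⟩
        simp [E]
    refine ⟨Equiv.ofBijective E hE, ?_⟩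
    intro j hj (v : Fin d × TreeWord d n) (w : Fin d × TreeWord d n)
    change TreeWord.Agree (n + 1) j v w ↔ f^[n + 1 - j] (E v) = f^[n + 1 - j] (E w)
    cases j with
    | zero => exact ⟨fun _ => by rw [Nat.sub_zero, (E v).2, (E w).2], fun _ => trivial⟩
    | succ j =>
      rw [Nat.add_sub_add_right]
      change (v.1 = w.1 ∧ TreeWord.Agree n j v.2 w.2) ↔ _
      obtain ⟨i, v⟩ := v
      obtain ⟨i', w⟩ := w
      constructor
      · rintro ⟨rfl : i = i', hvw⟩
        exact (he i j (by omega) v w).1 hvw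
      · intro hf
        have : i = i' := c.injective (Subtype.ext (by
          have := congrArg f^[j] hf
          rw [← Function.iterate_add_apply, ← Function.iterate_add_apply,
            Nat.add_sub_cancel' (by omega)] at this
          rw [← htop (i, v), ← htop (i', w), this]))
        subst this
        exact ⟨rfl, (he i j (by omega) v w).2 hf⟩

/-- A faithful permutation group on the `n`-th preimages which consists of all tree automorphisms is
isomorphic to `[S_d]^n`. -/
theorem nonempty_mulEquiv_iterSym {Ω H : Type*} [Group H] (f : Ω → Ω) (d : ℕ) [NeZero d] (n : ℕ)
    (x : Ω) (hcard : ∀ k < n, ∀ y, f^[k] y = x → Nat.card {z // f z = y} = d)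
    (ψ : H →* Equiv.Perm {y // f^[n] y = x}) (hψ : Function.Injective ψ)
    (hrange : ∀ π, π ∈ ψ.range ↔ ∀ j ≤ n, ∀ y z : {y // f^[n] y = x},
      f^[j] y = f^[j] z → f^[j] (π y) = f^[j] (π z)) :
    Nonempty (H ≃* IterSym d n) := by
  obtain ⟨e, he⟩ := exists_treeWord_equiv f d n x hcard
  let χ : H →* Equiv.Perm (TreeWord d n) := e.symm.permCongrHom.toMonoidHom.comp ψ
  have hχ : Function.Injective χ := e.symm.permCongrHom.injective.comp hψ
  have hr : χ.range = (IterSym.toPerm d n).range := by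
    ext π
    rw [IterSym.mem_range_toPerm_iff]
    have h1 : π ∈ χ.range ↔ e.permCongrHom π ∈ ψ.range := by
      constructor
      · rintro ⟨h, rfl⟩
        refine ⟨h, Equiv.ext fun y => ?_⟩
        simp [χ, Equiv.permCongrHom]
      · rintro ⟨h, hh⟩
        refine ⟨h, Equiv.ext fun y => ?_⟩
        simp [χ, Equiv.permCongrHom, hh]
    rw [h1, hrange]
    constructor
    · intro h j hj v w hvw
      have := h (n - j) (by omega) (e v) (e w) ((he j hj v w).1 hvw)
      simpa [Equiv.permCongrHom, ← he j hj] using this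
    · intro h j hj y z hyz
      obtain ⟨v, rfl⟩ := e.surjective y
      obtain ⟨w, rfl⟩ := e.surjective z
      have h2 := he (n - j) (by omega)
      rw [Nat.sub_sub_self hj] at h2
      rw [← h2] at hyz
      have := h _ (by omega) v w hyz
      rw [h2] at this
      simpa [Equiv.permCongrHom] using this
  exact ⟨(MonoidHom.ofInjective hχ).trans ((MulEquiv.subgroupCongr hr).trans
    (MonoidHom.ofInjective (IterSym.toPerm_injective d n)).symm)⟩

/-! ### Groups containing all tree automorphisms -/

section TreeAction

variable {G Ω : Type*} [Group G] [MulAction G Ω]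

theorem smul_iterate_of_commute {f : Ω → Ω} (hf : ∀ (g : G) y, f (g • y) = g • f y) (g : G)
    (n : ℕ) (y : Ω) : f^[n] (g • y) = g • f^[n] y := by
  induction n generalizing y with
  | zero => rfl
  | succ n ih => rw [Function.iterate_succ_apply, hf, ih, Function.iterate_succ_apply]

/-- The permutation representation of `G` on the `n`-th preimages of a fixed point of `G` under an
equivariant map. -/
def preimagePermHom (f : Ω → Ω) (hf : ∀ (g : G) y, f (g • y) = g • f y) (x : Ω)
    (hx : ∀ g : G, g • x = x) (n : ℕ) : G →* Equiv.Perm {y // f^[n] y = x} where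
  toFun g :=
    { toFun := fun y => ⟨g • (y : Ω), by rw [smul_iterate_of_commute hf, y.2, hx]⟩
      invFun := fun y => ⟨g⁻¹ • (y : Ω), by rw [smul_iterate_of_commute hf, y.2, hx]⟩
      left_inv := fun y => by simp
      right_inv := fun y => by simp }
  map_one' := by ext; simp
  map_mul' g h := by ext; simp [mul_smul]

@[simp]
theorem coe_preimagePermHom_apply (f : Ω → Ω) (hf : ∀ (g : G) y, f (g • y) = g • f y) (x : Ω)
    (hx : ∀ g : G, g • x = x) (n : ℕ) (g : G) (y : {y // f^[n] y = x}) :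
    (preimagePermHom f hf x hx n g y : Ω) = g • (y : Ω) := rfl

/-- `g` acts on `S` as the transposition of `a` and `b`. -/
def ActsAsSwap (S : Set Ω) (g : G) (a b : Ω) : Prop :=
  g • a = b ∧ g • b = a ∧ ∀ z ∈ S, z ≠ a → z ≠ b → g • z = z

theorem ActsAsSwap.symm {S : Set Ω} {g : G} {a b : Ω} (h : ActsAsSwap S g a b) :
    ActsAsSwap S g b a :=
  ⟨h.2.1, h.1, fun z hz ha hb => h.2.2 z hz hb ha⟩

theorem ActsAsSwap.conj {S : Set Ω} (hS : ∀ (g : G), ∀ z ∈ S, g • z ∈ S) {g : G} {a b : Ω}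
    (hg : ActsAsSwap S g a b) (h : G) : ActsAsSwap S (h * g * h⁻¹) (h • a) (h • b) := by
  refine ⟨by simp [mul_smul, hg.1], by simp [mul_smul, hg.2.1], fun z hz ha hb => ?_⟩
  rw [mul_smul, mul_smul, hg.2.2 _ (hS _ z hz), smul_inv_smul]
  · rintro rfl; simp at ha
  · rintro rfl; simp at hb

theorem eq_or_eq_of_natCard_le_three {α : Type*} [Finite α] (h : Nat.card α ≤ 3) {a b c e : α}
    (hab : a ≠ b) (hac : a ≠ c) (hbc : b ≠ c) : e = a ∨ e = b ∨ e = c := by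
  classical
  by_contra! hcon
  have := Fintype.ofFinite α
  have h4 : ({a, b, c, e} : Finset α).card = 4 := by
    rw [Finset.card_insert_of_notMem, Finset.card_insert_of_notMem, Finset.card_insert_of_notMem,
      Finset.card_singleton] <;> grind
  have := Finset.card_le_univ ({a, b, c, e} : Finset α)
  rw [Nat.card_eq_fintype_card] at h
  omega

/-- If `G` is transitive on an invariant set `S` fibred equivariantly into sets with two or three
elements and some element of `G` acts as a transposition inside a fibre, then all such transpositions
come from `G`. -/
theorem exists_actsAsSwap {f : Ω → Ω} (hf : ∀ (g : G) y, f (g • y) = g • f y) {S : Set Ω}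
    (hS : ∀ (g : G), ∀ z ∈ S, g • z ∈ S) (htrans : ∀ y ∈ S, ∀ z ∈ S, ∃ g : G, g • y = z)
    (hfin : ∀ y ∈ S, Finite {z // f z = f y}) (hcard : ∀ y ∈ S, Nat.card {z // f z = f y} ≤ 3)
    {a₀ b₀ : Ω} (ha₀ : a₀ ∈ S) (hab₀ : a₀ ≠ b₀) (hfab₀ : f a₀ = f b₀) {g₀ : G}
    (hg₀ : ActsAsSwap S g₀ a₀ b₀) {a b : Ω} (ha : a ∈ S) (hb : b ∈ S) (hab : a ≠ b)
    (hfab : f a = f b) : ∃ g : G, ActsAsSwap S g a b := by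
  obtain ⟨h, rfl⟩ := htrans a₀ ha₀ a ha
  have h1 := hg₀.conj hS h
  set c := h • b₀ with hc
  have hca : f c = f (h • a₀) := by rw [hc, hf, hf, hfab₀]
  have hac : h • a₀ ≠ c := fun e => hab₀ (MulAction.injective h e)
  have hcS : c ∈ S := hS _ _ (hg₀.1 ▸ hS _ _ ha₀)
  set a := h • a₀
  by_cases hbc : b = c
  · exact ⟨_, hbc ▸ h1⟩
  -- Here the fibre is `{a, b, c}` and `(a c)` is available. Moving `c` to `b` by `k` gives the
  -- transposition `(k • a, b)`, with `k • a` again in the fibre.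
  obtain ⟨k, hk⟩ := htrans c hcS b hb
  have h2 := h1.conj hS k
  rw [hk] at h2
  have hfk : f (k • a) = f a := by rw [hf, ← hca, ← hf, hk, ← hfab, hca]
  have := hfin _ ha
  have hkb : k • a ≠ b := fun e => hac (MulAction.injective k (e.trans hk.symm))
  rcases eq_or_eq_of_natCard_le_three (hcard _ ha) (a := ⟨a, rfl⟩) (b := ⟨b, hfab.symm⟩)
    (c := ⟨c, hca⟩) (e := ⟨k • a, hfk⟩) (by simpa using hab) (by simpa using hac)
    (by simpa using hbc) with e | e | e
  · rw [show k • a = a from congrArg Subtype.val e] at h2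
    exact ⟨_, h2⟩
  · exact absurd (congrArg Subtype.val e) hkb
  · rw [show k • a = c from congrArg Subtype.val e] at h2
    -- Conjugating `(c b)` by `(a c)` gives `(a b)`.
    have h3 := h2.conj hS (h * g₀ * h⁻¹)
    rw [h1.2.1, h1.2.2 b hb hab.symm hbc] at h3
    exact ⟨_, h3⟩

/-- A group acting on a tree of preimages with branching number two or three contains all tree
automorphisms as soon as it is transitive and contains a transposition at each level. -/
theorem mem_range_preimagePermHom_iff (f : Ω → Ω) (hf : ∀ (g : G) y, f (g • y) = g • f y) (x : Ω)
    (hx : ∀ g : G, g • x = x) {d : ℕ} (hd : d = 2 ∨ d = 3)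
    (hcard : ∀ n y, f^[n] y = x → Nat.card {z // f z = y} = d)
    (htrans : ∀ n y z, f^[n] y = x → f^[n] z = x → ∃ g : G, g • y = z)
    (hswap : ∀ n, ∃ a b, a ≠ b ∧ f a = f b ∧ f^[n + 1] a = x ∧
      ∃ g : G, ActsAsSwap {z | f^[n + 1] z = x} g a b) (n : ℕ)
    (π : Equiv.Perm {y // f^[n] y = x}) :
    π ∈ (preimagePermHom f hf x hx n).range ↔
      ∀ j ≤ n, ∀ y z : {y // f^[n] y = x}, f^[j] y = f^[j] z → f^[j] (π y) = f^[j] (π z) := by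
  classical
  constructor
  · rintro ⟨g, rfl⟩ j _ y z hyz
    simp [smul_iterate_of_commute hf, hyz]
  have : NeZero d := ⟨by omega⟩
  have hfin : ∀ m, Finite {y // f^[m] y = x} := fun m => by
    obtain ⟨e, -⟩ := exists_treeWord_equiv f d m x fun k _ => hcard k
    have hW : ∀ k, Finite (TreeWord d k) := fun k => by
      induction k with
      | zero => exact inferInstanceAs (Finite Unit)
      | succ k ih => exact inferInstanceAs (Finite (Fin d × TreeWord d k))
    have := hW m
    exact Finite.of_equiv _ e
  induction n with
  | zero =>
    intro _
    exact ⟨1, Equiv.ext fun y => Subtype.ext <| by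
      rw [map_one]
      exact y.2.trans (π y).2.symm⟩
  | succ n ih =>
    intro hπ
    have hstep : ∀ y, f^[n + 1] y = x → f^[n] (f y) = x := fun y hy => by
      rwa [← Function.iterate_succ_apply]
    have hlift : ∀ y : {y // f^[n] y = x}, ∃ z : {z // f^[n + 1] z = x}, f z = y := fun y => by
      have h0 : Nat.card {z // f z = (y : Ω)} ≠ 0 := by rw [hcard n y y.2]; omega
      obtain ⟨⟨z, hz⟩⟩ := (Nat.card_ne_zero.1 h0).1
      exact ⟨⟨z, by rw [Function.iterate_succ_apply, hz, y.2]⟩, hz⟩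
    choose l hl using hlift
    -- The permutation induced by `π` one level up; `hp` shows that it does not depend on the chosen
    -- lifts `l`.
    let p : {y // f^[n] y = x} → {y // f^[n] y = x} := fun y => ⟨f (π (l y)), hstep _ (π (l y)).2⟩
    have hp : ∀ z : {z // f^[n + 1] z = x}, (p ⟨f z, hstep _ z.2⟩ : Ω) = f (π z) := fun z =>
      hπ 1 (by omega) _ _ (hl _)
    have hpsurj : Function.Surjective p := fun y =>
      ⟨⟨f (π.symm (l y)), hstep _ (π.symm (l y)).2⟩, Subtype.ext (by rw [hp, Equiv.apply_symm_apply, hl])⟩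
    have := hfin n
    let π' : Equiv.Perm {y // f^[n] y = x} :=
      Equiv.ofBijective p (Finite.injective_iff_bijective.1 (Finite.injective_iff_surjective.2 hpsurj))
    obtain ⟨g, hg⟩ := ih π' fun j hj y z hyz => by
      have := hπ (j + 1) (by omega) (l y) (l z) (by
        rw [Function.iterate_succ_apply, Function.iterate_succ_apply, hl, hl, hyz])
      rwa [Function.iterate_succ_apply, Function.iterate_succ_apply] at this
    let ρ := preimagePermHom f hf x hx (n + 1)
    -- After correction by `g`, the permutation preserves every fibre of `f`, so sibling
    -- transpositions generate it.
    suffices hmem : ρ g⁻¹ * π ∈ ρ.range by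
      have := ρ.range.mul_mem ⟨g, rfl⟩ hmem
      rwa [← mul_assoc, ← map_mul, mul_inv_cancel, map_one, one_mul] at this
    have hsib : ∀ z : {z // f^[n + 1] z = x}, f ((ρ g⁻¹ * π) z) = f z := fun z => by
      have h1 : g • f z = f (π z) := by
        rw [← hp, ← coe_preimagePermHom_apply f hf x hx n g ⟨f z, hstep _ z.2⟩, hg]
        rfl
      rw [Equiv.Perm.mul_apply, coe_preimagePermHom_apply, hf, ← h1, inv_smul_smul]
    let T : Set (Equiv.Perm {z // f^[n + 1] z = x}) :=
      {τ | ∃ a b : {z // f^[n + 1] z = x}, a ≠ b ∧ f a = f b ∧ τ = Equiv.swap a b}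
    have hT : Subgroup.closure T ≤ ρ.range := by
      rw [Subgroup.closure_le]
      rintro _ ⟨a, b, hab, hfab, rfl⟩
      obtain ⟨a₀, b₀, hab₀, hfab₀, ha₀, g₀, hg₀⟩ := hswap n
      obtain ⟨k, hk⟩ := exists_actsAsSwap hf (S := {z | f^[n + 1] z = x})
        (fun g z (hz : _ = _) => by
          rw [Set.mem_ofPred_eq, smul_iterate_of_commute hf, hz, hx])
        (fun y hy z hz => htrans _ y z hy hz)
        (fun y hy => Nat.finite_of_card_ne_zero (by rw [hcard n _ (hstep y hy)]; omega))
        (fun y hy => by rw [hcard n _ (hstep y hy)]; omega)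
        ha₀ hab₀ hfab₀ hg₀ a.2 b.2 (fun h => hab (Subtype.ext h)) hfab
      refine ⟨k, Equiv.ext fun z => Subtype.ext ?_⟩
      rw [coe_preimagePermHom_apply]
      by_cases hza : z = a
      · rw [hza, Equiv.swap_apply_left, hk.1]
      by_cases hzb : z = b
      · rw [hzb, Equiv.swap_apply_right, hk.2.1]
      rw [Equiv.swap_apply_of_ne_of_ne hza hzb,
        hk.2.2 z z.2 (fun h => hza (Subtype.ext h)) fun h => hzb (Subtype.ext h)]
    have := hfin (n + 1)
    refine hT ((mem_closure_isSwap ?_).2 ⟨Set.toFinite _, fun z => ?_⟩)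
    · rintro _ ⟨a, b, hab, -, rfl⟩
      exact ⟨a, b, hab, rfl⟩
    · by_cases hz : (ρ g⁻¹ * π) z = z
      · rw [hz]
        exact MulAction.mem_orbit_self z
      · exact ⟨⟨_, Subgroup.subset_closure ⟨z, _, Ne.symm hz, (hsib z).symm, rfl⟩⟩,
          Equiv.swap_apply_left _ _⟩

end TreeAction

/-! ### The inertia field -/

open scoped Pointwise in
/-- The value group of the inertia field at a prime is that of the base field. -/
theorem exists_valuation_eq_of_inertia_fixed (K L : Type*) [Field K] [NumberField K] [Field L]
    [NumberField L] [Algebra K L] [IsGalois K L] (p : HeightOneSpectrum (𝓞 K))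
    (Q : HeightOneSpectrum (𝓞 L)) [Q.asIdeal.LiesOver p.asIdeal] :
    ∃ e : ℕ, e ≠ 0 ∧ (∀ x : K, Q.valuation L (algebraMap K L x) = p.valuation K x ^ e) ∧
      ∀ y : L, y ≠ 0 → (∀ σ ∈ Q.asIdeal.inertia Gal(L/K), σ y = y) →
        ∃ m : ℤ, Q.valuation L y = WithZero.exp m ^ e := by
  have : Finite (𝓞 K ⧸ p.asIdeal) := Ring.HasFiniteQuotients.finiteQuotient p.ne_bot
  let I := Q.asIdeal.inertia Gal(L/K)
  let F : IntermediateField K L := FixedPoints.intermediateField I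
  let q : HeightOneSpectrum (𝓞 F) :=
    ⟨Q.asIdeal.under (𝓞 F), inferInstance, Ideal.IsIntegral.comap_ne_bot _ Q.ne_bot⟩
  have : Q.asIdeal.LiesOver q.asIdeal := ⟨rfl⟩
  have : q.asIdeal.LiesOver p.asIdeal := Ideal.LiesOver.tower_bot Q.asIdeal q.asIdeal p.asIdeal
  have : Finite (𝓞 F ⧸ q.asIdeal) := Ring.HasFiniteQuotients.finiteQuotient q.ne_bot
  have : IsGaloisGroup I F L := IsGaloisGroup.subgroup Gal(L/K) K L I
  have : IsGaloisGroup Gal(L/K) (𝓞 K) (𝓞 L) := .of_isFractionRing _ _ _ K L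
  have : IsGaloisGroup I (𝓞 F) (𝓞 L) := .of_isFractionRing _ _ _ F L
  have h1 := Ideal.card_inertia_eq_ramificationIdxIn (G := Gal(L/K)) p.asIdeal Q.asIdeal
  have h2 := Ideal.card_inertia_eq_ramificationIdxIn (G := I) q.asIdeal Q.asIdeal
  rw [Ideal.ramificationIdxIn_eq_ramificationIdx p.asIdeal Q.asIdeal Gal(L/K)] at h1
  rw [Ideal.ramificationIdxIn_eq_ramificationIdx q.asIdeal Q.asIdeal I] at h2
  -- All of `I` is inertia over its fixed field `F`, so `Q` has ramification index `|I|` over `F` as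
  -- well as over `K`: both value groups embed with the same exponent.
  have h3 : Q.asIdeal.inertia I = ⊤ := by
    rw [eq_top_iff]
    exact fun σ _ => σ.2
  rw [h3, Subgroup.card_top] at h2
  have he : q.asIdeal.ramificationIdx' Q.asIdeal = p.asIdeal.ramificationIdx' Q.asIdeal := by
    rw [Ideal.ramificationIdx'_eq_ramificationIdx _ _ q.ne_bot,
      Ideal.ramificationIdx'_eq_ramificationIdx _ _ p.ne_bot, ← h1, ← h2]
  refine ⟨p.asIdeal.ramificationIdx' Q.asIdeal, ?_, fun x => ?_, fun y hy hfix => ?_⟩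
  · exact Ideal.IsDedekindDomain.ramificationIdx'_ne_zero_of_liesOver _ p.ne_bot
  · exact (HeightOneSpectrum.valuation_liesOver L p Q x).symm
  · let z : F := ⟨y, fun σ => hfix σ σ.2⟩
    have hz : z ≠ 0 := fun h => hy (congrArg Subtype.val h)
    have hv : q.valuation F z ≠ 0 := by simpa using hz
    refine ⟨WithZero.log (q.valuation F z), ?_⟩
    rw [WithZero.exp_log hv, ← he, HeightOneSpectrum.valuation_liesOver L q Q z]
    rfl

/-! ### Iterates, derivatives and discriminants -/

section IterateComp

variable {R : Type*} [CommRing R]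

namespace Polynomial

theorem iterate_comp_X_succ (f : R[X]) (n : ℕ) : f.comp^[n + 1] X = (f.comp^[n] X).comp f := by
  induction n with
  | zero => simp
  | succ n ih =>
    rw [Function.iterate_succ_apply', ih, ← comp_assoc, ← Function.iterate_succ_apply' f.comp n X,
      ih]

theorem eval_derivative_iterate_comp_X (f : R[X]) (n : ℕ) (y : R) :
    (derivative (f.comp^[n] X)).eval y =
      ∏ i ∈ Finset.range n, f.derivative.eval ((fun z => f.eval z)^[i] y) := by
  induction n with
  | zero => simp
  | succ n ih =>
    rw [Function.iterate_succ_apply', derivative_comp, eval_mul, ih, eval_comp,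
      iterate_comp_eval, eval_X, Finset.prod_range_succ, mul_comm]

theorem map_iterate_comp_X {S : Type*} [CommRing S] (φ : R →+* S) (f : R[X]) (n : ℕ) :
    (f.comp^[n] X).map φ = (f.map φ).comp^[n] X := by
  induction n with
  | zero => simp
  | succ n ih => rw [Function.iterate_succ_apply', map_comp, ih, Function.iterate_succ_apply']

theorem Monic.iterate_comp_X {f : R[X]} (hf : f.Monic) (hd : f.natDegree ≠ 0) (n : ℕ) :
    (f.comp^[n] X).Monic := by
  induction n with
  | zero => simp
  | succ n ih =>
    rw [iterate_comp_X_succ]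
    exact ih.comp hf hd

theorem Monic.natDegree_iterate_comp_X [Nontrivial R] {f : R[X]} (hf : f.Monic)
    (hd : f.natDegree ≠ 0) (n : ℕ) : (f.comp^[n] X).natDegree = f.natDegree ^ n := by
  induction n with
  | zero => simp
  | succ n ih =>
    rw [iterate_comp_X_succ, natDegree_comp_eq_of_mul_ne_zero, ih, pow_succ]
    simp [(hf.iterate_comp_X hd n).leadingCoeff, hf.leadingCoeff]

/-- The discriminant of a monic polynomial is, up to sign, the product of the values of the
derivative at the roots. -/
theorem Monic.map_discr_eq [IsDomain R] {M : Type*} [Field M] {g : R[X]} (hg : g.Monic)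
    (hdeg : 0 < g.natDegree) (φ : R →+* M) (hs : (g.map φ).Splits) :
    φ g.discr = (-1) ^ (g.natDegree * (g.natDegree - 1) / 2) *
      ((g.map φ).roots.map fun r => (derivative (g.map φ)).eval r).prod := by
  have h1 := resultant_deriv (f := g) (natDegree_pos_iff_degree_pos.1 hdeg)
  have h2 := resultant_eq_prod_eval (g.map φ) (derivative (g.map φ)) (g.natDegree - 1)
    ((natDegree_derivative_le _).trans (by rw [hg.natDegree_map])) hs
  rw [hg.natDegree_map, (hg.map φ).leadingCoeff, one_pow, one_mul, derivative_map,
    resultant_map_map, h1, hg.leadingCoeff, mul_one, map_mul, map_pow, map_neg, map_one] at h2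
  rw [derivative_map, ← h2, ← mul_assoc, ← mul_pow]
  simp

end Polynomial

end IterateComp

section IterSubC

variable {K : Type*} [Field K] {f : K[X]} {x₀ : K}

theorem eval_iterSubC (n : ℕ) (y : K) :
    (iterSubC f x₀ n).eval y = (fun z => f.eval z)^[n] y - x₀ := by
  simp [iterSubC]

theorem map_iterSubC {M : Type*} [Field M] (φ : K →+* M) (n : ℕ) :
    (iterSubC f x₀ n).map φ = iterSubC (f.map φ) (φ x₀) n := by
  simp [iterSubC, map_iterate_comp_X]

theorem natDegree_iterSubC (hf : f.Monic) (hd : f.natDegree ≠ 0) (n : ℕ) :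
    (iterSubC f x₀ n).natDegree = f.natDegree ^ n := by
  rw [iterSubC, natDegree_sub_C, hf.natDegree_iterate_comp_X hd]

theorem monic_iterSubC (hf : f.Monic) (hd : f.natDegree ≠ 0) (n : ℕ) :
    (iterSubC f x₀ n).Monic := by
  refine (hf.iterate_comp_X hd n).sub_of_left ?_
  refine degree_C_le.trans_lt (natDegree_pos_iff_degree_pos.1 ?_)
  rw [hf.natDegree_iterate_comp_X hd]
  exact Nat.pos_of_ne_zero (pow_ne_zero n hd)

theorem eval_derivative_iterSubC (n : ℕ) (y : K) :
    (derivative (iterSubC f x₀ n)).eval y =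
      ∏ i ∈ Finset.range n, f.derivative.eval ((fun z => f.eval z)^[i] y) := by
  rw [iterSubC, derivative_sub, derivative_C, sub_zero, eval_derivative_iterate_comp_X]

/-- Substitute `f` into the divisibility of `f^n(X) - x₀` by `X - y`. -/
theorem sub_C_dvd_iterSubC_succ (n : ℕ) {y : K} (hy : (fun z => f.eval z)^[n] y = x₀) :
    f - C y ∣ iterSubC f x₀ (n + 1) := by
  have h : IsRoot (iterSubC f x₀ n) y := by rw [IsRoot, eval_iterSubC, hy, sub_self]
  obtain ⟨q, hq⟩ := dvd_iff_isRoot.2 h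
  refine ⟨q.comp f, ?_⟩
  have := congrArg (fun r => r.comp f) hq
  simpa [iterSubC, iterate_comp_X_succ] using this

/-- `f - y` inherits splitting and separability from the polynomial it divides, so it has as many
distinct roots as its degree. -/
theorem natCard_fiber_eq (hf : f.Monic) (hd : f.natDegree ≠ 0) (n : ℕ)
    (hs : (iterSubC f x₀ (n + 1)).Splits) (hsep : (iterSubC f x₀ (n + 1)).Separable) {y : K}
    (hy : (fun z => f.eval z)^[n] y = x₀) : Nat.card {z // f.eval z = y} = f.natDegree := by
  have hdvd := sub_C_dvd_iterSubC_succ n hy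
  have hne := (monic_iterSubC (x₀ := x₀) hf hd (n + 1)).ne_zero
  have hs' : (f - C y).Splits := hs.of_dvd hne hdvd
  have hsep' := hsep.of_dvd hdvd
  have hne' : f - C y ≠ 0 := ne_zero_of_dvd_ne_zero hne hdvd
  have h1 := card_rootSet_eq_natDegree (K := K) hsep' (by simpa using hs')
  rw [natDegree_sub_C, ← Nat.card_eq_fintype_card] at h1
  rw [← h1]
  refine Nat.card_congr (Equiv.subtypeEquivRight fun z => ?_)
  rw [mem_rootSet_of_ne hne']
  simp [sub_eq_zero]

end IterSubC

/-! ### The Vandermonde product of a fibre -/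

section FieldIdentities

variable {L : Type*} [Field L]

theorem eval_X_pow_sub_C_mul_X (d : ℕ) (b z : L) :
    (X ^ d - C b * X : L[X]).eval z = z ^ d - b * z := by simp

theorem eval_derivative_X_pow_sub_C_mul_X (d : ℕ) (b z : L) :
    (derivative (X ^ d - C b * X : L[X])).eval z = d * z ^ (d - 1) - b := by
  simp [derivative_X_pow]

theorem monic_X_pow_sub_C_mul_X {d : ℕ} (hd : 2 ≤ d) (b : L) :
    (X ^ d - C b * X : L[X]).Monic :=
  (monic_X_pow d).sub_of_left (by
    rw [degree_X_pow]
    exact (degree_C_mul_X_le b).trans_lt (by exact_mod_cast hd))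

theorem natDegree_X_pow_sub_C_mul_X {d : ℕ} (hd : 2 ≤ d) (b : L) :
    (X ^ d - C b * X : L[X]).natDegree = d := by
  rw [natDegree_sub_eq_left_of_natDegree_lt, natDegree_X_pow]
  rw [natDegree_X_pow]
  exact ((natDegree_C_mul_le b X).trans natDegree_X_le).trans_lt hd

/-- In a fibre with two or three elements, the product of the derivatives is up to sign a square,
whose root is fixed by every permutation of the fibre which is not a transposition. -/
theorem exists_sq_eq_prod_derivative_fiber {d : ℕ} (hd : d = 2 ∨ d = 3) {b y : L} {S : Finset L}
    (hS : ∀ z, z ∈ S ↔ z ^ d - b * z = y) (hcard : S.card = d) :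
    ∃ w : L, (∏ z ∈ S, (d * z ^ (d - 1) - b) = w ^ 2 ∨ ∏ z ∈ S, (d * z ^ (d - 1) - b) = -w ^ 2) ∧
      ∀ (G : Type*) [Group G] [MulSemiringAction G L] (σ : G), (∀ z ∈ S, σ • z ∈ S) → σ • w = w ∨
        ∃ a ∈ S, ∃ c ∈ S, a ≠ c ∧ ActsAsSwap (S : Set L) σ a c := by
  classical
  rcases hd with rfl | rfl
  · obtain ⟨z₁, z₂, h12, rfl⟩ := Finset.card_eq_two.1 hcard
    have e1 := (hS z₁).1 (by simp)
    have e2 := (hS z₂).1 (by simp)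
    -- Hence `f'(z₁) = z₁ - z₂` and `f'(z₂) = z₂ - z₁`.
    have e3 : z₁ + z₂ = b := by
      have : (z₁ - z₂) * (z₁ + z₂ - b) = 0 := by linear_combination e1 - e2
      rcases mul_eq_zero.1 this with h | h
      · exact absurd (sub_eq_zero.1 h) h12
      · exact sub_eq_zero.1 h
    refine ⟨z₁ - z₂, Or.inr ?_, fun G _ _ σ hσ => ?_⟩
    · rw [Finset.prod_pair h12, ← e3]
      push_cast
      ring
    · have s1 := hσ z₁ (by simp)
      have s2 := hσ z₂ (by simp)
      have i12 : σ • z₁ ≠ σ • z₂ := fun h => h12 (MulAction.injective σ h)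
      simp only [Finset.mem_insert, Finset.mem_singleton] at s1 s2
      rcases s1 with s1 | s1
      · left
        rw [smul_sub]
        grind
      · right
        refine ⟨z₁, by simp, z₂, by simp, h12, s1, by grind, ?_⟩
        simp only [Finset.coe_insert, Finset.coe_singleton, Set.mem_insert_iff,
          Set.mem_singleton_iff]
        grind
  · obtain ⟨z₁, z₂, z₃, h12, h13, h23, rfl⟩ := Finset.card_eq_three.1 hcard
    have e1 := (hS z₁).1 (by simp)
    have e2 := (hS z₂).1 (by simp)
    have e3 := (hS z₃).1 (by simp)
    have e4 : z₁ ^ 2 + z₁ * z₂ + z₂ ^ 2 = b := by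
      have : (z₁ - z₂) * (z₁ ^ 2 + z₁ * z₂ + z₂ ^ 2 - b) = 0 := by linear_combination e1 - e2
      rcases mul_eq_zero.1 this with h | h
      · exact absurd (sub_eq_zero.1 h) h12
      · exact sub_eq_zero.1 h
    have e5 : z₁ ^ 2 + z₁ * z₃ + z₃ ^ 2 = b := by
      have : (z₁ - z₃) * (z₁ ^ 2 + z₁ * z₃ + z₃ ^ 2 - b) = 0 := by linear_combination e1 - e3
      rcases mul_eq_zero.1 this with h | h
      · exact absurd (sub_eq_zero.1 h) h13
      · exact sub_eq_zero.1 h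
    have e6 : z₁ + z₂ + z₃ = 0 := by
      have : (z₂ - z₃) * (z₁ + z₂ + z₃) = 0 := by linear_combination e4 - e5
      rcases mul_eq_zero.1 this with h | h
      · exact absurd (sub_eq_zero.1 h) h23
      · exact h
    have e7 : z₃ = -z₁ - z₂ := by linear_combination e6
    refine ⟨(z₁ - z₂) * (z₁ - z₃) * (z₂ - z₃), Or.inr ?_, fun G _ _ σ hσ => ?_⟩
    · rw [Finset.prod_insert (by simp [h12, h13]), Finset.prod_pair h23, ← e4, e7]
      push_cast
      ring
    · have s1 := hσ z₁ (by simp)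
      have s2 := hσ z₂ (by simp)
      have s3 := hσ z₃ (by simp)
      have i12 : σ • z₁ ≠ σ • z₂ := fun h => h12 (MulAction.injective σ h)
      have i13 : σ • z₁ ≠ σ • z₃ := fun h => h13 (MulAction.injective σ h)
      have i23 : σ • z₂ ≠ σ • z₃ := fun h => h23 (MulAction.injective σ h)
      simp only [Finset.mem_insert, Finset.mem_singleton] at s1 s2 s3
      simp only [smul_mul', smul_sub, Finset.coe_insert, Finset.coe_singleton,
        Finset.mem_insert, Finset.mem_singleton, ActsAsSwap, Set.mem_insert_iff,
          Set.mem_singleton_iff]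
      -- Of the six permutations, the identity and the 3-cycles preserve the Vandermonde product;
      -- the other three are transpositions.
      rcases s1 with s1 | s1 | s1 <;> rcases s2 with s2 | s2 | s2 <;>
        first
        | exact absurd (s1.trans s2.symm) i12
        | rcases s3 with s3 | s3 | s3 <;>
          first
          | exact absurd (s1.trans s3.symm) i13
          | exact absurd (s2.trans s3.symm) i23
          | (left; rw [s1, s2, s3]; done)
          | (left; rw [s1, s2, s3]; ring1)
          | (right; exact ⟨z₁, by simp, z₂, by simp, h12, s1, s2, by
              rintro z (rfl | rfl | rfl) ha hc <;>
                first | exact absurd rfl ha | exact absurd rfl hc | assumption⟩)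
          | (right; exact ⟨z₁, by simp, z₃, by simp, h13, s1, s3, by
              rintro z (rfl | rfl | rfl) ha hc <;>
                first | exact absurd rfl ha | exact absurd rfl hc | assumption⟩)
          | (right; exact ⟨z₂, by simp, z₃, by simp, h23, s2, s3, by
              rintro z (rfl | rfl | rfl) ha hc <;>
                first | exact absurd rfl ha | exact absurd rfl hc | assumption⟩)

end FieldIdentities

/-! ### Valuation estimates on preimages -/

section Valuation

variable {L Γ : Type*} [Field L] [LinearOrderedCommGroupWithZero Γ] (v : Valuation L Γ)
  {d : ℕ} {b x₀ : L}

/-- If `v y > 1`, then `y ^ d` dominates `b * y` and the image of `y` is again non-integral, against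
induction. -/
theorem valuation_le_one_of_iterate_eq (hd : 2 ≤ d) (hb : v b ≤ 1) (hx : v x₀ ≤ 1) (n : ℕ) {y : L}
    (hy : (fun z => z ^ d - b * z)^[n] y = x₀) : v y ≤ 1 := by
  induction n generalizing y with
  | zero =>
    rw [← hy] at hx
    exact hx
  | succ n ih =>
    have h1 := ih hy
    by_contra! hlt
    have h2 : v (b * y) < v (y ^ d) := by
      rw [map_mul, map_pow]
      calc v b * v y ≤ v y := mul_le_of_le_one_left' hb
        _ = v y ^ 1 := (pow_one _).symm
        _ < v y ^ d := pow_lt_pow_right₀ hlt hd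
    change v (y ^ d - b * y) ≤ 1 at h1
    rw [Valuation.map_sub_eq_of_lt_left v h2, map_pow] at h1
    exact absurd h1 (not_le.2 (one_lt_pow₀ hlt (by omega)))

theorem valuation_add_le_one {x y : L} (hx : v x ≤ 1) (hy : v y ≤ 1) : v (x + y) ≤ 1 :=
  v.integer.add_mem hx hy

theorem valuation_sub_le_one {x y : L} (hx : v x ≤ 1) (hy : v y ≤ 1) : v (x - y) ≤ 1 :=
  v.integer.sub_mem hx hy

theorem valuation_mul_le_one {x y : L} (hx : v x ≤ 1) (hy : v y ≤ 1) : v (x * y) ≤ 1 :=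
  v.integer.mul_mem hx hy

theorem valuation_pow_le_one {x : L} (hx : v x ≤ 1) (n : ℕ) : v (x ^ n) ≤ 1 :=
  v.integer.pow_mem hx n

theorem valuation_natCast_le_one (n : ℕ) : v (n : L) ≤ 1 :=
  natCast_mem v.integer n

theorem valuation_derivative_le_one (hb : v b ≤ 1) {z : L} (hz : v z ≤ 1) :
    v (d * z ^ (d - 1) - b) ≤ 1 :=
  valuation_sub_le_one v
    (valuation_mul_le_one v (valuation_natCast_le_one v d) (valuation_pow_le_one v hz _)) hb

theorem valuation_image_sub_le (hd : d = 2 ∨ d = 3) (hb : v b ≤ 1) {y z : L} (hy : v y ≤ 1)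
    (hz : v z ≤ 1) : v ((y ^ d - b * y) - (z ^ d - b * z)) ≤ v (y - z) := by
  obtain ⟨c, hc, h⟩ : ∃ c, v c ≤ 1 ∧ (y ^ d - b * y) - (z ^ d - b * z) = c * (y - z) := by
    rcases hd with rfl | rfl
    · exact ⟨y + z - b, valuation_sub_le_one v (valuation_add_le_one v hy hz) hb, by ring⟩
    · refine ⟨y ^ 2 + y * z + z ^ 2 - b, valuation_sub_le_one v (valuation_add_le_one v
        (valuation_add_le_one v (valuation_pow_le_one v hy _) (valuation_mul_le_one v hy hz))
        (valuation_pow_le_one v hz _)) hb, by ring⟩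
  rw [h, map_mul]
  exact mul_le_of_le_one_left' hc

/-- For siblings `y ≠ z`, eliminating `b` shows that `f'(y)` is an integral multiple of `y - z`: the
cofactor is `1` for `d = 2` and `2 * y + z` for `d = 3`. -/
theorem valuation_derivative_le_of_fiber (hd : d = 2 ∨ d = 3) {y z : L} (hy : v y ≤ 1)
    (hz : v z ≤ 1) (hyz : y ≠ z) (h : y ^ d - b * y = z ^ d - b * z) :
    v (d * y ^ (d - 1) - b) ≤ v (y - z) := by
  obtain ⟨c, hc, h⟩ : ∃ c, v c ≤ 1 ∧ d * y ^ (d - 1) - b = c * (y - z) := by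
    rcases hd with rfl | rfl
    · refine ⟨1, by simp, mul_left_cancel₀ (sub_ne_zero.2 hyz) ?_⟩
      push_cast
      linear_combination h
    · refine ⟨2 * y + z, valuation_add_le_one v (valuation_mul_le_one v
        (by exact_mod_cast valuation_natCast_le_one v 2) hy) hz,
        mul_left_cancel₀ (sub_ne_zero.2 hyz) ?_⟩
      push_cast
      linear_combination h
  rw [h, map_mul]
  exact mul_le_of_le_one_left' hc

/-- If the derivative is a unit at all preimages up to level `n`, then distinct `n`-th preimages stay
distinct in the residue field. -/
theorem valuation_sub_eq_one_of_iterate_eq (hd : d = 2 ∨ d = 3) (hb : v b ≤ 1) (hx : v x₀ ≤ 1)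
    (n : ℕ) (hU : ∀ m < n, ∀ y, (fun z => z ^ d - b * z)^[m + 1] y = x₀ →
      v (d * y ^ (d - 1) - b) = 1) {y z : L} (hy : (fun z => z ^ d - b * z)^[n] y = x₀)
    (hz : (fun z => z ^ d - b * z)^[n] z = x₀) (hyz : y ≠ z) : v (y - z) = 1 := by
  have hd2 : 2 ≤ d := by omega
  induction n generalizing y z with
  | zero => exact absurd (hy.trans hz.symm) hyz
  | succ n ih =>
    have vy := valuation_le_one_of_iterate_eq v hd2 hb hx _ hy
    have vz := valuation_le_one_of_iterate_eq v hd2 hb hx _ hz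
    refine le_antisymm (valuation_sub_le_one v vy vz) ?_
    by_cases hf : y ^ d - b * y = z ^ d - b * z
    · rw [← hU n (by omega) y hy]
      exact valuation_derivative_le_of_fiber v hd vy vz hyz hf
    · rw [← ih (fun m hm => hU m (by omega)) hy hz hf]
      exact valuation_image_sub_le v hd hb vy vz

theorem iterate_neg_of_odd (b y : L) (n : ℕ) :
    (fun z => z ^ 3 - b * z)^[n] (-y) = -(fun z => z ^ 3 - b * z)^[n] y := by
  induction n generalizing y with
  | zero => rfl
  | succ n ih =>
    rw [Function.iterate_succ_apply, Function.iterate_succ_apply, ← ih]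
    congr 1
    ring

theorem valuation_iterate_sub_le (hd : d = 2 ∨ d = 3) (hb : v b ≤ 1) (n : ℕ) {y z : L}
    (hy : v y ≤ 1) (hz : v z ≤ 1) :
    v ((fun z => z ^ d - b * z)^[n] y - (fun z => z ^ d - b * z)^[n] z) ≤ v (y - z) := by
  induction n generalizing y z with
  | zero => rfl
  | succ n ih =>
    have hf : ∀ {u : L}, v u ≤ 1 → v (u ^ d - b * u) ≤ 1 := fun hu =>
      valuation_sub_le_one v (valuation_pow_le_one v hu d) (valuation_mul_le_one v hb hu)
    exact (ih (hf hy) (hf hz)).trans (valuation_image_sub_le v hd hb hy hz)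

/-- Critical points reduce to a single fibre. -/
theorem image_eq_of_valuation_derivative_lt (hd : d = 2 ∨ d = 3) (hb : v b ≤ 1) (hx : v x₀ = 1)
    (hvd : v (d : L) = 1) (hvd' : v ((d : L) - 1) = 1) (n : ℕ)
    (hU : ∀ m < n, ∀ y, (fun z => z ^ d - b * z)^[m + 1] y = x₀ → v (d * y ^ (d - 1) - b) = 1)
    {y z : L} (hy : (fun z => z ^ d - b * z)^[n + 1] y = x₀)
    (hz : (fun z => z ^ d - b * z)^[n + 1] z = x₀) (hy' : v (d * y ^ (d - 1) - b) < 1)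
    (hz' : v (d * z ^ (d - 1) - b) < 1) : y ^ d - b * y = z ^ d - b * z := by
  have hd2 : 2 ≤ d := by omega
  have vy := valuation_le_one_of_iterate_eq v hd2 hb hx.le _ hy
  have vz := valuation_le_one_of_iterate_eq v hd2 hb hx.le _ hz
  by_contra hne
  have h1 : v ((y ^ d - b * y) - (z ^ d - b * z)) = 1 :=
    valuation_sub_eq_one_of_iterate_eq v hd hb hx.le n hU hy hz hne
  have h2 : v (y - z) = 1 := le_antisymm (valuation_sub_le_one v vy vz)
    (h1.symm.le.trans (valuation_image_sub_le v hd hb vy vz))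
  have h3 := v.map_sub_lt hy' hz'
  rcases hd with rfl | rfl
  · rw [show ((2 : ℕ) : L) * y ^ (2 - 1) - b - ((2 : ℕ) * z ^ (2 - 1) - b) = (2 : ℕ) * (y - z) by
      push_cast; ring, map_mul, hvd, h2, mul_one] at h3
    exact lt_irrefl _ h3
  -- The difference of derivatives is `3 * (y - z) * (y + z)`, so `y` and `-z` are congruent. As `f`
  -- is odd, their iterates `x₀` and `-x₀` would be congruent too, but `2 * x₀` is a unit.
  · have h4 : v (y - -z) < 1 := by
      rwa [show ((3 : ℕ) : L) * y ^ (3 - 1) - b - ((3 : ℕ) * z ^ (3 - 1) - b) =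
        (3 : ℕ) * (y - z) * (y - -z) by push_cast; ring, map_mul, map_mul, hvd, h2, one_mul,
        one_mul] at h3
    have h5 := valuation_iterate_sub_le v (d := 3) (by simp) hb (n + 1) vy
      (by rwa [Valuation.map_neg] : v (-z) ≤ 1)
    rw [iterate_neg_of_odd, hy, hz, show x₀ - -x₀ = (((3 : ℕ) : L) - 1) * x₀ by push_cast; ring,
      map_mul, hvd', hx, one_mul] at h5
    exact absurd h5 (not_le.2 h4)

end Valuation

/-! ### From an odd discriminant to a transposition -/

theorem valuation_discr_iterSubC {K L Γ : Type*} [Field K] [Field L]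
    [LinearOrderedCommGroupWithZero Γ] (v : Valuation L Γ) (φ : K →+* L) {f : K[X]} {x₀ : K}
    (hf : f.Monic) (hd : f.natDegree ≠ 0) (n : ℕ) (hs : ((iterSubC f x₀ n).map φ).Splits)
    (hsep : (iterSubC f x₀ n).Separable) :
    ∃ R : Finset L, (∀ z, z ∈ R ↔ (fun z => (f.map φ).eval z)^[n] z = φ x₀) ∧
      v (φ (iterSubC f x₀ n).discr) = ∏ r ∈ R, ∏ i ∈ Finset.range n,
        v ((derivative (f.map φ)).eval ((fun z => (f.map φ).eval z)^[i] r)) := by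
  have hm := monic_iterSubC (x₀ := x₀) hf hd n
  have hpos : 0 < (iterSubC f x₀ n).natDegree := by
    rw [natDegree_iterSubC hf hd]
    exact Nat.pos_of_ne_zero (pow_ne_zero n hd)
  refine ⟨⟨_, nodup_roots (hsep.map (f := φ))⟩, fun z => ?_, ?_⟩
  · rw [Finset.mem_mk, mem_roots (hm.map φ).ne_zero, IsRoot, map_iterSubC, eval_iterSubC,
      sub_eq_zero]
  · rw [hm.map_discr_eq hpos φ hs, map_mul, map_pow, Valuation.map_neg, map_one, one_pow, one_mul,
      map_multiset_prod, Multiset.map_map, Finset.prod]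
    congr 1
    refine Multiset.map_congr rfl fun r _ => ?_
    rw [Function.comp_apply, map_iterSubC, eval_derivative_iterSubC, map_prod]

/-- Inertia is defined on `𝓞 L`; the congruence passes to all `Q`-integral elements by clearing a
denominator prime to `Q`. -/
theorem valuation_sub_lt_one_of_mem_inertia {K L : Type*} [Field K] [Field L] [NumberField L]
    [Algebra K L] (Q : HeightOneSpectrum (𝓞 L)) {σ : Gal(L/K)} (hσ : σ ∈ Q.asIdeal.inertia Gal(L/K))
    {z : L} (hz : Q.valuation L z ≤ 1) : Q.valuation L (σ z - z) < 1 := by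
  obtain ⟨a, c, hac⟩ := Q.exists_primeCompl_mul_eq_of_integer z hz
  have hlt : ∀ u : 𝓞 L, Q.valuation L (σ (algebraMap (𝓞 L) L u) - algebraMap (𝓞 L) L u) < 1 :=
    fun u => (Q.valuation_lt_one_iff_mem (K := L) (σ • u - u)).2 (hσ u)
  have hc : Q.valuation L (algebraMap (𝓞 L) L c) = 1 :=
    Q.valuation_eq_one_iff_notMem.2 c.2
  have hσc : Q.valuation L (σ (algebraMap (𝓞 L) L c)) = 1 := by
    have := Q.valuation L |>.map_add_eq_of_lt_right (hc.symm ▸ hlt c)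
    rwa [sub_add_cancel, hc] at this
  have key : (σ z - z) * σ (algebraMap (𝓞 L) L c) = (σ (algebraMap (𝓞 L) L a) -
      algebraMap (𝓞 L) L a) - z * (σ (algebraMap (𝓞 L) L c) - algebraMap (𝓞 L) L c) := by
    have := congrArg σ hac
    rw [map_mul] at this
    linear_combination this - hac
  have h := (Q.valuation L).map_sub_lt (hlt a)
    (show Q.valuation L (z * (σ (algebraMap (𝓞 L) L c) - algebraMap (𝓞 L) L c)) < 1 by
      rw [map_mul]
      exact (mul_le_of_le_one_left' hz).trans_lt (hlt c))
  rwa [← key, map_mul, hσc, mul_one] at h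

/-- If the discriminant of `f^(n+1) - x₀` has odd valuation at a prime at which the previous
discriminants are units, then some automorphism of a Galois extension splitting `f^(n+1) - x₀` acts
on the roots as a transposition inside a fibre of `f`. -/
theorem exists_actsAsSwap_of_odd_discr (K L : Type*) [Field K] [NumberField K] [Field L]
    [NumberField L] [Algebra K L] [IsGalois K L] {d : ℕ} (hd : d = 2 ∨ d = 3) {b x₀ : K} {f : K[X]}
    (hf : f = X ^ d - C b * X) (n : ℕ) (p : HeightOneSpectrum (𝓞 K))
    (hb : p.valuation K b ≤ 1) (hx : p.valuation K x₀ = 1) (hpd : p.valuation K (d : K) = 1)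
    (hpd' : p.valuation K ((d : K) - 1) = 1)
    (hodd : ∃ k : ℤ, 0 < k ∧ Odd k ∧ HasOrd p (iterSubC f x₀ (n + 1)).discr k)
    (hunit : ∀ l < n + 1, HasOrd p (iterSubC f x₀ l).discr 0)
    (hs : ∀ l ≤ n + 1, ((iterSubC f x₀ l).map (algebraMap K L)).Splits)
    (hsep : ∀ l, (iterSubC f x₀ l).Separable) :
    ∃ a c : L, a ≠ c ∧ aeval a f = aeval c f ∧
      (fun z => aeval z f)^[n + 1] a = algebraMap K L x₀ ∧ ∃ σ : Gal(L/K),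
        ActsAsSwap {z : L | (fun z => aeval z f)^[n + 1] z = algebraMap K L x₀} σ a c := by
  classical
  have hd2 : 2 ≤ d := by omega
  have hfm : f.Monic := hf ▸ monic_X_pow_sub_C_mul_X hd2 b
  have hfd : f.natDegree = d := hf ▸ natDegree_X_pow_sub_C_mul_X hd2 b
  have hfd0 : f.natDegree ≠ 0 := by omega
  obtain ⟨⟨P, hPm, hPp⟩⟩ := (inferInstance : Nonempty (p.asIdeal.primesOver (𝓞 L)))
  let Q : HeightOneSpectrum (𝓞 L) := ⟨P, hPm, Ideal.ne_bot_of_liesOver_of_ne_bot p.ne_bot P⟩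
  have : Q.asIdeal.LiesOver p.asIdeal := hPp
  obtain ⟨e, he, hval, hfix⟩ := exists_valuation_eq_of_inertia_fixed K L p Q
  let φ := algebraMap K L
  set v := Q.valuation L with hv
  let B := φ b
  let x := φ x₀
  let F : L → L := fun z => z ^ d - B * z
  have hfF : f.map φ = X ^ d - C B * X := by simp [hf, B]
  have hevalF : (fun z => (f.map φ).eval z) = F := by
    funext z
    rw [hfF, eval_X_pow_sub_C_mul_X]
  have haevalF : (fun z => aeval z f) = F := by
    rw [← hevalF]
    funext z
    rw [eval_map_algebraMap]
  have hder : ∀ z, (derivative (f.map φ)).eval z = d * z ^ (d - 1) - B := fun z => by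
    rw [hfF, eval_derivative_X_pow_sub_C_mul_X]
  have vB : v B ≤ 1 := by rw [hval]; exact pow_le_one' hb e
  have vx : v x = 1 := by rw [hval, hx, one_pow]
  have vd : v (d : L) = 1 := by rw [← map_natCast φ, hval, hpd, one_pow]
  have vd' : v ((d : L) - 1) = 1 := by
    rw [← map_natCast φ, ← map_one φ, ← map_sub, hval, hpd', one_pow]
  have hF1 : ∀ {z : L}, v z ≤ 1 → v (F z) ≤ 1 := fun hz =>
    valuation_sub_le_one v (valuation_pow_le_one v hz d) (valuation_mul_le_one v vB hz)
  have hFi : ∀ (i : ℕ) {z : L}, v z ≤ 1 → v (F^[i] z) ≤ 1 := fun i => by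
    induction i with
    | zero => exact fun hz => hz
    | succ i ih => exact fun hz => ih (hF1 hz)
  have hder1 : ∀ {z : L}, v z ≤ 1 → v (d * z ^ (d - 1) - B) ≤ 1 := fun hz =>
    valuation_derivative_le_one v vB hz
  have hR : ∀ l ≤ n + 1, ∃ R : Finset L, (∀ z, z ∈ R ↔ F^[l] z = x) ∧
      v (φ (iterSubC f x₀ l).discr) =
        ∏ r ∈ R, ∏ i ∈ Finset.range l, v (d * F^[i] r ^ (d - 1) - B) := fun l hl => by
    have := valuation_discr_iterSubC v φ hfm hfd0 l (hs l hl) (hsep l)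
    simpa only [hder, hevalF] using this
  have hint : ∀ l z, F^[l] z = x → v z ≤ 1 := fun l z hz =>
    valuation_le_one_of_iterate_eq v hd2 vB vx.le l hz
  -- A product of integral factors is a unit only if each factor is; the factor with `i = 0` is
  -- `f'(y)`.
  have hU : ∀ m < n, ∀ y, F^[m + 1] y = x → v (d * y ^ (d - 1) - B) = 1 := fun m hm y hy => by
    obtain ⟨R, hRmem, hRv⟩ := hR (m + 1) (by omega)
    rw [hval, show p.valuation K _ = _ from hunit (m + 1) (by omega), neg_zero, WithZero.exp_zero,
      one_pow] at hRv
    have h1 := (Finset.prod_eq_one_iff_of_le_one' fun r hr => Finset.prod_le_one' fun i _ =>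
      hder1 (hFi i (hint _ r ((hRmem r).1 hr)))).1 hRv.symm y ((hRmem y).2 hy)
    exact (Finset.prod_eq_one_iff_of_le_one' fun i _ => hder1 (hFi i (hint _ y hy))).1 h1 0
      (by simp)
  obtain ⟨k, hk0, hkodd, hk⟩ := hodd
  obtain ⟨R, hRmem, hRv⟩ := hR (n + 1) le_rfl
  have hRv' : WithZero.exp (-k) ^ e = ∏ r ∈ R, v (d * r ^ (d - 1) - B) := by
    rw [← show p.valuation K _ = _ from hk, ← hval, hRv]
    refine Finset.prod_congr rfl fun r hr => ?_
    -- By `hU`, only the factor `i = 0` can be a non-unit: the others evaluate `f'` on lower levels.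
    rw [Finset.prod_range_succ', Finset.prod_eq_one, one_mul]
    · rfl
    · intro i hi
      refine hU (n - (i + 1)) (by rw [Finset.mem_range] at hi; omega) _ ?_
      rw [← Function.iterate_add_apply,
        show n - (i + 1) + 1 + (i + 1) = n + 1 by rw [Finset.mem_range] at hi; omega]
      exact (hRmem r).1 hr
  have hlt : (WithZero.exp (-k) : WithZero (Multiplicative ℤ)) ^ e < 1 := by
    refine pow_lt_one₀ zero_le ?_ he
    rw [← WithZero.exp_zero, WithZero.exp_lt_exp]
    omega
  obtain ⟨r₀, hr₀, hr₀lt⟩ : ∃ r ∈ R, v (d * r ^ (d - 1) - B) < 1 := by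
    by_contra! hcon
    refine (hRv' ▸ hlt).ne (Finset.prod_eq_one fun r hr => le_antisymm ?_ (hcon r hr))
    exact hder1 (hint _ r ((hRmem r).1 hr))
  let y₀ := F r₀
  have hy₀ : F^[n] y₀ = x := (hRmem r₀).1 hr₀
  let S := R.filter fun z => F z = y₀
  have hSmem : ∀ z, z ∈ S ↔ F z = y₀ := fun z => by
    rw [Finset.mem_filter, and_iff_right_iff_imp, hRmem]
    intro hz
    rw [Function.iterate_succ_apply, hz, hy₀]
  have hSR : S ⊆ R := Finset.filter_subset _ _
  have hone : ∀ r ∈ R, r ∉ S → v (d * r ^ (d - 1) - B) = 1 := fun r hr hrS => by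
    refine le_antisymm (hder1 (hint _ r ((hRmem r).1 hr))) (not_lt.1 fun hr' => hrS ?_)
    exact (hSmem r).2 (image_eq_of_valuation_derivative_lt v hd vB vx vd vd' n hU
      ((hRmem r).1 hr) ((hRmem r₀).1 hr₀) hr' hr₀lt)
  have hScard : S.card = d := by
    have h1 := natCard_fiber_eq (f := f.map φ) (x₀ := x) (hfm.map φ)
      (by rwa [hfm.natDegree_map]) n (by rw [← map_iterSubC]; exact hs _ le_rfl)
      (by rw [← map_iterSubC]; exact (hsep _).map) (y := y₀) (by rw [hevalF]; exact hy₀)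
    rw [hfm.natDegree_map, hfd] at h1
    rw [← h1, ← Nat.card_eq_finsetCard]
    refine Nat.card_congr (Equiv.subtypeEquivRight fun z => ?_)
    rw [hSmem, ← hevalF]
  obtain ⟨w, hw, hwσ⟩ := exists_sq_eq_prod_derivative_fiber hd hSmem hScard
  have hvw : WithZero.exp (-k) ^ e = v w ^ 2 := by
    rw [hRv', ← Finset.prod_subset hSR hone, ← map_prod, ← map_pow]
    rcases hw with hw | hw
    · rw [hw]
    · rw [hw, Valuation.map_neg]
  have hw0 : w ≠ 0 := by
    rintro rfl
    simp at hvw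
  obtain ⟨σ, hσ, hσw⟩ : ∃ σ ∈ Q.asIdeal.inertia Gal(L/K), σ • w ≠ w := by
    by_contra! hcon
    -- If inertia fixed `w`, then `v w` would be an `e`-th power; cancelling `e` makes `k` even.
    obtain ⟨m, hm⟩ := hfix w hw0 hcon
    rw [hv, hm, ← pow_mul, ← WithZero.exp_nsmul, ← WithZero.exp_nsmul, WithZero.exp_inj] at hvw
    have hk2 : -k = 2 * m := by
      refine mul_left_cancel₀ (Nat.cast_ne_zero.2 he : (e : ℤ) ≠ 0) ?_
      simp only [nsmul_eq_mul, Nat.cast_mul] at hvw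
      rw [hvw]
      push_cast
      ring
    obtain ⟨j, hj⟩ := hkodd
    omega
  have hlt1 : ∀ z : L, v z ≤ 1 → v (z - σ z) < 1 := fun z hz => by
    rw [Valuation.map_sub_swap]
    exact valuation_sub_lt_one_of_mem_inertia Q hσ hz
  have hσF : ∀ z, σ (F z) = F (σ z) := fun z => by
    simp only [F, map_sub, map_mul, map_pow]
    rw [show σ B = B from σ.commutes b]
  have hσFi : ∀ (l : ℕ) z, F^[l] z = x → F^[l] (σ z) = x := fun l z hz => by
    rw [← Function.Commute.iterate_right (f := σ) (g := F) hσF l z, hz]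
    exact σ.commutes x₀
  have hfixn : ∀ u, F^[n] u = x → σ u = u := fun u hu => by
    by_contra hne
    exact (hlt1 u (hint n u hu)).ne (valuation_sub_eq_one_of_iterate_eq v hd vB vx.le n hU hu
      (hσFi n u hu) (Ne.symm hne))
  have hσS : ∀ z ∈ S, σ • z ∈ S := fun z hz => by
    rw [hSmem] at hz ⊢
    rw [AlgEquiv.smul_def, ← hσF, hz, hfixn y₀ hy₀]
  rcases hwσ Gal(L/K) σ hσS with h | ⟨a, ha, c, hc, hac, hswap⟩
  · exact absurd h hσw
  have hevalfun : ∀ z, aeval z f = F z := fun z => congrFun haevalF z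
  refine ⟨a, c, hac, ?_, ?_, σ, hswap.1, hswap.2.1, fun z hz hza hzc => ?_⟩
  · rw [hevalfun, hevalfun, (hSmem a).1 ha, (hSmem c).1 hc]
  · rw [haevalF]
    exact (hRmem a).1 (hSR ha)
  · rw [Set.mem_ofPred_eq, haevalF] at hz
    by_cases hzS : z ∈ S
    · exact hswap.2.2 z hzS hza hzc
    · by_contra hne
      have vz := hint _ z hz
      -- A root `z` outside `S` moved by `σ` would be a sibling of `σ z` and congruent to it, so
      -- `f'(z)` would not be a unit, contrary to `hone`.
      refine ((valuation_derivative_le_of_fiber v hd vz (hint _ _ (hσFi _ z hz)) (Ne.symm hne)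
        ?_).trans_lt (hlt1 z vz)).ne (hone z ((hRmem z).2 hz) hzS)
      change F z = F (σ z)
      rw [← hσF, hfixn (F z) hz]

/-! ### Irreducibility by Eisenstein's criterion -/

theorem Polynomial.iterate_X_pow_comp_X {R : Type*} [CommRing R] (d n : ℕ) :
    (X ^ d : R[X]).comp^[n] X = X ^ d ^ n := by
  induction n with
  | zero => simp
  | succ n ih => rw [Function.iterate_succ_apply', ih, X_pow_comp, ← pow_mul, pow_succ]

/-- If `v(b) < 1` and `v(x₀)` generates the value group, then all `f^n(x) - x₀` are irreducible. -/
theorem irreducible_iterSubC {K : Type*} [Field K] (v : Valuation K (WithZero (Multiplicative ℤ)))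
    {d : ℕ} (hd : 2 ≤ d) {b x₀ : K} (hb : v b < 1) (hx : v x₀ = WithZero.exp (-1 : ℤ)) (n : ℕ) :
    Irreducible (iterSubC (X ^ d - C b * X) x₀ n) := by
  let A := v.valuationSubring
  let m := IsLocalRing.maximalIdeal A
  have hx1 : v x₀ < 1 := by
    rw [hx, ← WithZero.exp_zero, WithZero.exp_lt_exp]
    omega
  let B : A := ⟨b, hb.le⟩
  let x : A := ⟨x₀, hx1.le⟩
  have hBm : B ∈ m := (Valuation.mem_maximalIdeal_iff K v).2 hb
  have hxm : x ∈ m := (Valuation.mem_maximalIdeal_iff K v).2 hx1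
  let F : A[X] := X ^ d - C B * X
  have hFdeg : (C B * X : A[X]).degree < d :=
    (degree_C_mul_X_le B).trans_lt (by exact_mod_cast hd)
  have hFm : F.Monic := (monic_X_pow d).sub_of_left (by rwa [degree_X_pow])
  have hFd : F.natDegree = d := by
    refine natDegree_eq_of_degree_eq_some ?_
    rw [degree_sub_eq_left_of_degree_lt (by rwa [degree_X_pow]), degree_X_pow]
  let g : A[X] := F.comp^[n] X - C x
  have hiter := hFm.natDegree_iterate_comp_X (by omega) n
  have hgpos : 0 < g.natDegree := by
    rw [natDegree_sub_C, hiter, hFd]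
    positivity
  have hgm : g.Monic := by
    refine (hFm.iterate_comp_X (by omega) n).sub_of_left
      (degree_C_le.trans_lt (natDegree_pos_iff_degree_pos.1 ?_))
    rw [hiter, hFd]
    positivity
  have hmap : g.map (algebraMap A K) = iterSubC (X ^ d - C b * X) x₀ n := by
    have h1 : F.map (algebraMap A K) = X ^ d - C b * X := by
      simp only [F, Polynomial.map_sub, Polynomial.map_pow, map_X, Polynomial.map_mul, map_C]
      rfl
    rw [iterSubC, ← h1, ← map_iterate_comp_X, Polynomial.map_sub, map_C]
    rfl
  rw [← hmap, ← hgm.irreducible_iff_irreducible_map_fraction_map]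
  -- Both `b` and `x₀` vanish in the residue field, leaving the iterate of `X ^ d`.
  have hres : g.map (IsLocalRing.residue A) = X ^ d ^ n := by
    rw [Polynomial.map_sub, map_iterate_comp_X, map_C, (IsLocalRing.residue_eq_zero_iff x).2 hxm,
      Polynomial.map_sub, Polynomial.map_mul, map_C, (IsLocalRing.residue_eq_zero_iff B).2 hBm]
    simp [iterate_X_pow_comp_X]
  have heis : g.IsEisensteinAt m := by
    refine ⟨?_, fun {i} hi => ?_, fun h => ?_⟩
    · rw [hgm.leadingCoeff]
      exact (Ideal.ne_top_iff_one m).1 (IsLocalRing.maximalIdeal.isMaximal A).ne_top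
    · rw [← IsLocalRing.residue_eq_zero_iff, ← coeff_map, hres, coeff_X_pow, if_neg]
      rw [natDegree_sub_C, hiter, hFd] at hi
      exact hi.ne
    · have hF0 : (fun z => F.eval z)^[n] 0 = 0 := by
        refine Function.iterate_fixed ?_ n
        simp [F, show d ≠ 0 by omega]
      have h0 : g.coeff 0 = -x := by
        rw [coeff_zero_eq_eval_zero, eval_sub, iterate_comp_eval, eval_X, hF0, eval_C, zero_sub]
      rw [h0, neg_mem_iff, pow_two] at h
      have hle : ∀ z : WithZero (Multiplicative ℤ), z < 1 → z ≤ WithZero.exp (-1 : ℤ) := by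
        intro z hz
        rcases eq_or_ne z 0 with rfl | hz0
        · exact zero_le
        · rw [← WithZero.exp_log hz0, ← WithZero.exp_zero, WithZero.exp_lt_exp] at hz
          rw [← WithZero.exp_log hz0, WithZero.exp_le_exp]
          omega
      -- Values below `1` are at most `exp (-1)`, so elements of `m * m` have value at most `exp
      -- (-2)`, which excludes `x₀`.
      have key : ∀ z ∈ m * m, v (z : K) ≤ WithZero.exp (-2 : ℤ) := fun z hz => by
        induction hz using Submodule.mul_induction_on' with
        | mem_mul_mem y hy z hz =>
          rw [show ((y * z : A) : K) = (y : K) * z from rfl, map_mul,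
            show (-2 : ℤ) = -1 + -1 by norm_num, WithZero.exp_add]
          exact mul_le_mul' (hle _ ((Valuation.mem_maximalIdeal_iff K v).1 hy))
            (hle _ ((Valuation.mem_maximalIdeal_iff K v).1 hz))
        | add y hy z hz ihy ihz => exact (v.map_add _ _).trans (max_le ihy ihz)
      have h2 := key x h
      rw [show v (x : K) = _ from hx, WithZero.exp_le_exp] at h2
      omega
  exact heis.irreducible inferInstance hgm.isPrimitive hgpos

/-! ### The fields generated by preimages -/

section PreimageField

variable {K : Type*} [Field K] {f : K[X]} {x₀ : K}

theorem rootSet_iterSubC {M : Type*} [Field M] [Algebra K M] (hf : f.Monic) (hd : f.natDegree ≠ 0)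
    (n : ℕ) :
    (iterSubC f x₀ n).rootSet M = {y | (fun z => aeval z f)^[n] y = algebraMap K M x₀} := by
  ext y
  rw [mem_rootSet_of_ne (monic_iterSubC hf hd n).ne_zero, Set.mem_ofPred_eq, ← eval_map_algebraMap,
    map_iterSubC, eval_iterSubC, sub_eq_zero]
  simp only [eval_map_algebraMap]

theorem isGalois_preimageField (hf : f.Monic) (hd : f.natDegree ≠ 0) (n : ℕ)
    (hsep : (iterSubC f x₀ n).Separable) :
    IsGalois K (preimageField f x₀ n) ∧ FiniteDimensional K (preimageField f x₀ n) := by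
  have h := IntermediateField.adjoin_rootSet_isSplittingField
    (IsAlgClosed.splits ((iterSubC f x₀ n).map (algebraMap K (AlgebraicClosure K))))
  rw [rootSet_iterSubC hf hd n] at h
  have h' : IsSplittingField K (preimageField f x₀ n) (iterSubC f x₀ n) := h
  exact ⟨IsGalois.of_separable_splitting_field hsep,
    IsSplittingField.finiteDimensional _ (iterSubC f x₀ n)⟩

theorem exists_iterate_eq_of_isAlgClosed {M : Type*} [Field M] [IsAlgClosed M] {g : M[X]}
    (hg : g.natDegree ≠ 0) (n : ℕ) (y : M) : ∃ z, (fun z => g.eval z)^[n] z = y := by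
  have hsurj : Function.Surjective fun z => g.eval z := fun y => by
    obtain ⟨z, hz⟩ := IsAlgClosed.exists_root (g - C y) (by
      intro h
      exact hg (by rw [← natDegree_sub_C (a := y)]; exact natDegree_eq_of_degree_eq_some h))
    exact ⟨z, by simpa [sub_eq_zero] using hz⟩
  exact hsurj.iterate n y

/-- Over the algebraic closure `f` is surjective, so each `l`-th preimage is the image under
`f^(n-l)` of an `n`-th preimage, and the field is closed under `f`. -/
theorem iterPreimage_subset_preimageField (hd : f.natDegree ≠ 0) {l n : ℕ} (hl : l ≤ n) :
    iterPreimage f x₀ l ⊆ preimageField f x₀ n := by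
  intro y hy
  let g := f.map (algebraMap K (AlgebraicClosure K))
  obtain ⟨z, hz⟩ := exists_iterate_eq_of_isAlgClosed (g := g) (by rwa [natDegree_map]) (n - l) y
  have hfun : (fun z => g.eval z) = fun z => aeval z f := by
    funext z
    rw [eval_map_algebraMap]
  rw [hfun] at hz
  have hzn : z ∈ iterPreimage f x₀ n := by
    change _ = _
    rw [← Nat.add_sub_cancel' hl, Function.iterate_add_apply, hz]
    exact hy
  have hmem : ∀ i, (fun z => aeval z f)^[i] z ∈ preimageField f x₀ n := fun i => by
    induction i with
    | zero => exact IntermediateField.subset_adjoin K _ hzn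
    | succ i ih =>
      rw [Function.iterate_succ_apply']
      have := (aeval (⟨_, ih⟩ : preimageField f x₀ n) f).2
      rwa [← IntermediateField.coe_val, ← aeval_algHom_apply] at this
  exact hz ▸ hmem (n - l)

theorem aeval_algEquiv_smul {M : Type*} [Field M] [Algebra K M] (f : K[X]) (g : Gal(M/K)) (y : M) :
    aeval (g • y) f = g • aeval y f := by
  rw [AlgEquiv.smul_def, AlgEquiv.smul_def]
  exact aeval_algHom_apply g y f

end PreimageField

/-! ### The Galois group of the preimage field -/

theorem theorem3p2 (K : Type*) [Field K] [NumberField K] (d : ℕ) (hd : d = 2 ∨ d = 3)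
    (b x₀ : K) (s t u w : 𝓞 K) (ht : t ≠ 0) (hw : w ≠ 0)
    (hx₀ : x₀ = (s : K) / (t : K)) (hb : b = (u : K) / (w : K))
    (hst : IsCoprime s t) (huw : IsCoprime u w)
    (f : K[X]) (hf : f = X ^ d - C b * X)
    -- condition (1): `v(b) ≥ 1` (with `v(0) = ∞`) and `v(x₀) = 1` for some prime
    (h1 : ∃ 𝔭₁ : HeightOneSpectrum (𝓞 K),
      𝔭₁.valuation K b ≤ WithZero.exp (-1 : ℤ) ∧ HasOrd 𝔭₁ x₀ 1)
    -- condition (3), with `m = 1`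
    (h3 : ∀ n : ℕ, 1 ≤ n → ∃ 𝔭 : HeightOneSpectrum (𝓞 K),
      s * t * u * w * (d : 𝓞 K) * ((d : 𝓞 K) - 1) ∉ 𝔭.asIdeal ∧
      (∃ k : ℤ, 0 < k ∧ Odd k ∧ HasOrd 𝔭 (iterSubC f x₀ n).discr k) ∧
      ∀ l : ℕ, l < n → HasOrd 𝔭 (iterSubC f x₀ l).discr 0) :
    ∀ n : ℕ, Nonempty
      ((preimageField f x₀ n ≃ₐ[K] preimageField f x₀ n) ≃* IterSym d n) := by
  have hd2 : 2 ≤ d := by omega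
  have : NeZero d := ⟨by omega⟩
  have hfm : f.Monic := hf ▸ monic_X_pow_sub_C_mul_X hd2 b
  have hfd : f.natDegree = d := hf ▸ natDegree_X_pow_sub_C_mul_X hd2 b
  have hfd0 : f.natDegree ≠ 0 := by omega
  have hirr : ∀ n, Irreducible (iterSubC f x₀ n) := fun n => by
    obtain ⟨p₁, hp₁b, hp₁x⟩ := h1
    rw [hf]
    refine irreducible_iterSubC (p₁.valuation K) hd2 (hp₁b.trans_lt ?_) hp₁x n
    rw [← WithZero.exp_zero, WithZero.exp_lt_exp]
    omega
  have hsep : ∀ n, (iterSubC f x₀ n).Separable := fun n => (hirr n).separable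
  let Ω := AlgebraicClosure K
  let G := Gal(Ω/K)
  let F : Ω → Ω := fun z => aeval z f
  let x : Ω := algebraMap K Ω x₀
  have hF : ∀ (g : G) y, F (g • y) = g • F y := aeval_algEquiv_smul f
  have hx : ∀ g : G, g • x = x := fun g => g.commutes x₀
  have hFeval : (fun z => (f.map (algebraMap K Ω)).eval z) = F := by
    funext z
    rw [eval_map_algebraMap]
  have hcard : ∀ n y, F^[n] y = x → Nat.card {z // F z = y} = d := fun n y hy => by
    have := natCard_fiber_eq (x₀ := x) (hfm.map (algebraMap K Ω))
      (by rwa [natDegree_map]) n (IsAlgClosed.splits _)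
      (by rw [← map_iterSubC]; exact (hsep _).map) (y := y) (by rw [hFeval]; exact hy)
    rw [natDegree_map, hfd] at this
    rw [← this, ← hFeval]
  have htrans : ∀ n y z, F^[n] y = x → F^[n] z = x → ∃ g : G, g • y = z := fun n y z hy hz => by
    have hmin : ∀ y, F^[n] y = x → iterSubC f x₀ n = minpoly K y := fun y hy => by
      refine minpoly.eq_of_irreducible_of_monic (hirr n) ?_ (monic_iterSubC hfm hfd0 n)
      have : y ∈ (iterSubC f x₀ n).rootSet Ω := by
        rw [rootSet_iterSubC hfm hfd0]
        exact hy
      exact aeval_eq_zero_of_mem_rootSet this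
    exact (Normal.minpoly_eq_iff_mem_orbit Ω).1 ((hmin z hz).symm.trans (hmin y hy))
  have hswap : ∀ n, ∃ a c, a ≠ c ∧ F a = F c ∧ F^[n + 1] a = x ∧
      ∃ g : G, ActsAsSwap {z | F^[n + 1] z = x} g a c := fun n => by
    obtain ⟨p, hp, hodd, hunit⟩ := h3 (n + 1) (by omega)
    let L := preimageField f x₀ (n + 1)
    obtain ⟨_, _⟩ := isGalois_preimageField hfm hfd0 (n + 1) (hsep (n + 1))
    have : NumberField L := NumberField.of_module_finite K L
    have hunits : ∀ r : 𝓞 K, r ∣ s * t * u * w * (d : 𝓞 K) * ((d : 𝓞 K) - 1) →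
        p.valuation K (r : K) = 1 := fun r hr =>
      p.valuation_eq_one_iff_notMem.2 fun h => hp (Ideal.mem_of_dvd _ hr h)
    have hvb : p.valuation K b = 1 := by
      rw [hb, map_div₀, hunits u ⟨s * t * w * d * (d - 1), by ring⟩,
        hunits w ⟨s * t * u * d * (d - 1), by ring⟩, div_one]
    have hvx : p.valuation K x₀ = 1 := by
      rw [hx₀, map_div₀, hunits s ⟨t * u * w * d * (d - 1), by ring⟩,
        hunits t ⟨s * u * w * d * (d - 1), by ring⟩, div_one]
    have hvd : p.valuation K (d : K) = 1 := by
      simpa using hunits d ⟨s * t * u * w * (d - 1), by ring⟩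
    have hvd' : p.valuation K ((d : K) - 1) = 1 := by
      simpa using hunits (d - 1) ⟨s * t * u * w * d, by ring⟩
    obtain ⟨a, c, hac, hfac, han, σ, hσ⟩ := exists_actsAsSwap_of_odd_discr K L hd hf n p hvb.le hvx
      hvd hvd' hodd hunit (fun l hl => IntermediateField.splits_of_splits (IsAlgClosed.splits _) (by
        rw [rootSet_iterSubC hfm hfd0]
        exact iterPreimage_subset_preimageField hfd0 hl)) hsep
    have hcoe : ∀ z : L, ((aeval z f : L) : Ω) = F z := fun z =>
      (aeval_algebraMap_apply Ω z f).symm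
    have hcoei : ∀ (k : ℕ) (z : L), (((fun z => aeval z f)^[k] z : L) : Ω) = F^[k] z := fun k =>
      Function.Semiconj.iterate_right (f := fun z : L => (z : Ω)) hcoe k
    have hcoex : ((algebraMap K L x₀ : L) : Ω) = x := rfl
    -- The transposition found in `Gal(L/K)` is lifted to the absolute Galois group, which acts on
    -- all levels at once.
    obtain ⟨g, rfl⟩ := AlgEquiv.restrictNormalHom_surjective (K₁ := L) Ω σ
    have hg : ∀ z : L, g • (z : Ω) = ((AlgEquiv.restrictNormalHom L g) z : L) := fun z =>
      (AlgEquiv.restrictNormalHom_apply L g z).symm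
    refine ⟨a, c, fun h => hac (Subtype.ext h), ?_, ?_, g, ?_, ?_, fun z hz hza hzc => ?_⟩
    · rw [← hcoe, ← hcoe, hfac]
    · rw [← hcoei, han, hcoex]
    · rw [hg]
      exact congrArg _ hσ.1
    · rw [hg]
      exact congrArg _ hσ.2.1
    · let z' : L := ⟨z, iterPreimage_subset_preimageField hfd0 le_rfl hz⟩
      have := hσ.2.2 z' (Subtype.ext ((hcoei _ z').trans hz)) (fun h => hza (congrArg Subtype.val h))
        fun h => hzc (congrArg Subtype.val h)
      exact (hg z').trans (congrArg _ this)
  intro n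
  let L := preimageField f x₀ n
  obtain ⟨_, _⟩ := isGalois_preimageField hfm hfd0 n (hsep n)
  let ρ := preimagePermHom F hF x hx n
  obtain ⟨e⟩ := nonempty_mulEquiv_iterSym F d n x (fun k _ => hcard k) ρ.range.subtype
    (Subgroup.subtype_injective _) (by
      intro π
      rw [Subgroup.range_subtype]
      exact mem_range_preimagePermHom_iff F hF x hx hd hcard htrans hswap n π)
  -- An automorphism is trivial on `L` exactly when it fixes the generating preimages, so `Gal(L/K)`
  -- is the image of `ρ`.
  have hker : (AlgEquiv.restrictNormalHom L : G →* Gal(L/K)).ker = ρ.ker := by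
    rw [IntermediateField.restrictNormalHom_ker]
    apply le_antisymm
    · intro g hg
      refine Equiv.ext fun y => Subtype.ext ?_
      exact (IntermediateField.mem_fixingSubgroup_iff L g).1 hg y
        (IntermediateField.subset_adjoin K _ y.2)
    · rw [← IntermediateField.le_iff_le]
      refine IntermediateField.adjoin_le_iff.2 fun y hy g => ?_
      exact congrArg Subtype.val (Equiv.congr_fun (show ρ g = 1 from g.2) ⟨y, hy⟩)
  exact ⟨(QuotientGroup.quotientKerEquivOfSurjective (AlgEquiv.restrictNormalHom L : G →* Gal(L/K))
    (AlgEquiv.restrictNormalHom_surjective Ω)).symm.trans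
      ((QuotientGroup.quotientMulEquivOfEq hker).trans
        ((QuotientGroup.quotientKerEquivRange ρ).trans e))⟩
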